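/- Let $\mathbb H$ be a Hadamard manifold, i.e. a complete, simply connected, smooth $n$-dimensional Riemannian manifold of nonpositive sectional curvature, with exponential maps $\exp_p:T_p\mathbb H\to\mathbb H$ (which are bijective) and Riemannian metric $\langle\cdot,\cdot\rangle$. Let $\emptyset\ne\mathcal K\subseteq\mathbb H$ be geodesically convex, i.e. $\exp_p(t\exp_p^{-1}q)\in\mathcal K$ for all $p,q\in\mathcal K$ and $t\in[0,1]$, and let $\Psi=(\Psi_1,\dots,\Psi_m):\mathcal K\to\mathbb R^m$. Let each $\Psi_i$ be extended to a function $\mathbb H\to[-\infty,+\infty]$, again denoted $\Psi_i$. For $p\in\mathcal K$ and $v\in T_p\mathbb H$ put $$\Psi_i^-(p;v)=\liminf_{t\downarrow0}\frac{\Psi_i(\exp_p tv)-\Psi_i(p)}{t},\qquad \Psi_i^+(p;v)=\limsup_{t\downarrow0}\frac{\Psi_i(\exp_p tv)-\Psi_i(p)}{t}.$$ A closed set $C\subseteq T_p\mathbb H$ is a convexificator of $\Psi_i$ at $p$ if, for every $v\in T_p\mathbb H$, $\Psi_i^-(p;v)\le\sup_{\xi\in C}\langle\xi,v\rangle$ and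 $\Psi_i^+(p;v)\ge\inf_{\xi\in C}\langle\xi,v\rangle$. Let $\bar p\in\mathcal K$. Suppose that each $\Psi_i:\mathcal K\to\mathbb R$ is locally Lipschitz at $\bar p$ and that $\partial^*_*\Psi_i(\bar p)$ is a bounded convexificator of $\Psi_i$ at $\bar p$ $(i=1,\dots,m)$. Put $\partial^*_*\Psi(\bar p)=\partial^*_*\Psi_1(\bar p)\times\dots\times\partial^*_*\Psi_m(\bar p)$ and $\langle\xi;v\rangle_m=(\langle\xi_1,v\rangle,\dots,\langle\xi_m,v\rangle)$. Suppose that 1. $\Psi$ is $\partial^*_*$-convex at $\bar p$ over $\mathcal K$: for all $q\in\mathcal K$, all $\xi\in\partial^*_*\Psi(\bar p)$ and all $i$, $\Psi_i(q)-\Psi_i(\bar p)\ge\langle\xi_i,\exp_{\bar p}^{-1}q\rangle$; 2. $\bar p$ solves the Stampacchia $\partial^*_*$-VVIP (vector variational inequality problem): for every $q\in\mathcal K$ there is $\xi\in\partial^*_*\Psi(\bar p)$ with $\langle\xi;\exp_{\bar p}^{-1}q\rangle_m\notin-\mathbb R^m_+\setminus\{0\}$. Then $\bar p$ is an efficient (minimal)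 point of the vector optimization problem of minimizing $\Psi$ over $\mathcal K$: $\Psi(q)-\Psi(\bar p)\notin-\mathbb R^m_+\setminus\{0\}$ for all $q\in\mathcal K$. -/

import Mathlib

open Set Filter Topology Bundle
open scoped Manifold ContDiff

noncomputable section

namespace Hadamard

/-! ### Riemannian geometry in coordinates

`M` is an `n`-dimensional smooth manifold (without boundary) whose tangent spaces carry a
Riemannian metric. All coordinate expressions refer to the chart `extChartAt` centred at a point
`x`, and `y` is a point of the coordinate space. -/

section Coordinates

variable {n : ℕ} {M : Type*} [TopologicalSpace M] [ChartedSpace (EuclideanSpace ℝ (Fin n)) M]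
  [RiemannianBundle (fun x : M ↦ TangentSpace (𝓡 n) x)]

/-- The coordinate vector `∂ᵢ` of the chart at `x`, at the point with coordinates `y`. -/
def coordVec (x : M) (y : EuclideanSpace ℝ (Fin n)) (i : Fin n) :
    TangentSpace (𝓡 n)
      ((extChartAt (𝓡 n) x).symm y) :=
  mfderiv (𝓡 n) (𝓡 n)
    (extChartAt (𝓡 n) x).symm y
    ((NormedSpace.fromTangentSpace y).symm (EuclideanSpace.single i (1 : ℝ)))

/-- The metric coefficients `gᵢⱼ(y) = ⟨∂ᵢ, ∂ⱼ⟩` in the chart at `x`. -/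
def metricMatrix (x : M) (y : EuclideanSpace ℝ (Fin n)) : Matrix (Fin n) (Fin n) ℝ :=
  Matrix.of fun i j ↦ inner ℝ (coordVec x y i) (coordVec x y j)

/-- The partial derivative `∂ₗ f (y)` on the coordinate space. -/
def partialDeriv (l : Fin n) (f : EuclideanSpace ℝ (Fin n) → ℝ) (y : EuclideanSpace ℝ (Fin n)) :
    ℝ :=
  fderiv ℝ f y (EuclideanSpace.single l (1 : ℝ))

/-- The Christoffel symbols of the Levi-Civita connection in the chart at `x`,
`Γᵏᵢⱼ = ½ ∑ₗ gᵏˡ (∂ᵢ gⱼₗ + ∂ⱼ gᵢₗ - ∂ₗ gᵢⱼ)`. -/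
def christoffel (x : M) (k i j : Fin n) (y : EuclideanSpace ℝ (Fin n)) : ℝ :=
  (1 / 2 : ℝ) * ∑ l, (metricMatrix x y)⁻¹ k l *
    (partialDeriv i (fun z ↦ metricMatrix x z j l) y
      + partialDeriv j (fun z ↦ metricMatrix x z i l) y
      - partialDeriv l (fun z ↦ metricMatrix x z i j) y)

/-- The components `Rˡᵢⱼₖ` of the Riemann curvature tensor in the chart at `x`, with
`R(∂ᵢ, ∂ⱼ)∂ₖ = ∇ᵢ∇ⱼ∂ₖ - ∇ⱼ∇ᵢ∂ₖ = ∑ₗ Rˡᵢⱼₖ ∂ₗ`. -/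
def riemannTensor (x : M) (l i j k : Fin n) (y : EuclideanSpace ℝ (Fin n)) : ℝ :=
  partialDeriv i (christoffel x l j k) y - partialDeriv j (christoffel x l i k) y
    + ∑ h, (christoffel x l i h y * christoffel x h j k y
      - christoffel x l j h y * christoffel x h i k y)

/-- The metric `⟨u, v⟩` of two coordinate vectors at `y`. -/
def coordInner (x : M) (y : EuclideanSpace ℝ (Fin n)) (u v : Fin n → ℝ) : ℝ :=
  ∑ i, ∑ j, metricMatrix x y i j * u i * v j

/-- The sectional curvature at the point `x` of the plane spanned by the tangent vectors with
coordinates `u` and `v`,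
`⟨R(u, v)v, u⟩ / (⟨u, u⟩⟨v, v⟩ - ⟨u, v⟩²)`; it is meant for linearly independent `u` and `v`. -/
def sectionalCurvature (x : M) (u v : Fin n → ℝ) : ℝ :=
  let y := extChartAt (𝓡 n) x x
  coordInner x y (fun l ↦ ∑ i, ∑ j, ∑ k, riemannTensor x l i j k y * u i * v j * v k) u
    / (coordInner x y u u * coordInner x y v v - coordInner x y u v ^ 2)

variable (n) in
/-- A smooth curve `γ : ℝ → M` is a geodesic if `∇_{γ'} γ' = 0`, that is, if its coordinate
expression `c` satisfies `c''ₖ + ∑ᵢⱼ Γᵏᵢⱼ(c) c'ᵢ c'ⱼ = 0`. The equation at time `t` is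
written in the chart at `γ t` (it does not depend on the chart). -/
def IsGeodesic (γ : ℝ → M) : Prop :=
  ContMDiff 𝓘(ℝ, ℝ) (𝓡 n) ∞ γ ∧
  ∀ t : ℝ, ∀ k : Fin n,
    let c : Fin n → ℝ → ℝ := fun i s ↦
      extChartAt (𝓡 n) (γ t) (γ s) i
    deriv (deriv (c k)) t
      + ∑ i, ∑ j, christoffel (γ t) k i j
          (extChartAt (𝓡 n) (γ t) (γ t))
        * deriv (c i) t * deriv (c j) t = 0

/-- `γ 0 = p` and `γ' 0 = v`, as an equation in the tangent bundle. -/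
def HasInitialData (γ : ℝ → M) (p : M)
    (v : TangentSpace (𝓡 n) p) : Prop :=
  tangentMap 𝓘(ℝ, ℝ) (𝓡 n) γ ⟨0, (1 : ℝ)⟩ = ⟨p, v⟩

open Classical in
/-- The exponential map: `exp_p v = γ 1` for the geodesic `γ` with `γ 0 = p`, `γ' 0 = v`.
(On a complete manifold this geodesic exists, and it is unique.) -/
def expMap (p : M) (v : TangentSpace (𝓡 n) p) : M :=
  if h : ∃ γ : ℝ → M, IsGeodesic n γ ∧ HasInitialData γ p v then h.choose 1 else p

variable (n) in
/-- The inverse `exp_p⁻¹ q` of the exponential map (a bijection on a Hadamard manifold). -/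
def logMap (p q : M) : TangentSpace (𝓡 n) p :=
  Function.invFun (expMap p) q

variable (n) in
/-- Geodesic convexity: with `p` and `q`, the set contains every `exp_p (t exp_p⁻¹ q)`,
`0 ≤ t ≤ 1`. -/
def GeodesicallyConvex (K : Set M) : Prop :=
  ∀ p ∈ K, ∀ q ∈ K, ∀ t ∈ Icc (0 : ℝ) 1, expMap p (t • logMap n p q) ∈ K

/-! ### Dini derivatives and convexificators -/

/-- The lower Dini derivative `f⁻(p; v)` of an extended real-valued function. -/
def lowerDini (f : M → EReal) (p : M)
    (v : TangentSpace (𝓡 n) p) : EReal :=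
  liminf (fun t : ℝ ↦ (f (expMap p (t • v)) - f p) / (t : EReal)) (𝓝[>] 0)

/-- The upper Dini derivative `f⁺(p; v)` of an extended real-valued function. -/
def upperDini (f : M → EReal) (p : M)
    (v : TangentSpace (𝓡 n) p) : EReal :=
  limsup (fun t : ℝ ↦ (f (expMap p (t • v)) - f p) / (t : EReal)) (𝓝[>] 0)

/-- `C` is an upper convexificator of `f` at `p`. -/
def IsUpperConvexificator (f : M → EReal) (p : M)
    (C : Set (TangentSpace (𝓡 n) p)) : Prop :=
  IsClosed C ∧ ∀ v : TangentSpace (𝓡 n) p,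
    lowerDini f p v ≤ ⨆ ξ ∈ C, ((inner ℝ ξ v : ℝ) : EReal)

/-- `C` is a lower convexificator of `f` at `p`. -/
def IsLowerConvexificator (f : M → EReal) (p : M)
    (C : Set (TangentSpace (𝓡 n) p)) : Prop :=
  IsClosed C ∧ ∀ v : TangentSpace (𝓡 n) p,
    (⨅ ξ ∈ C, ((inner ℝ ξ v : ℝ) : EReal)) ≤ upperDini f p v

/-- `C` is a convexificator of `f` at `p`: both an upper and a lower one. -/
def IsConvexificator (f : M → EReal) (p : M)
    (C : Set (TangentSpace (𝓡 n) p)) : Prop :=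
  IsUpperConvexificator f p C ∧ IsLowerConvexificator f p C

/-! ### Vector optimization and vector variational inequalities -/

/-- The vector `⟨ξ; v⟩ₘ = (⟨ξ₁, v⟩, …, ⟨ξₘ, v⟩)`. -/
def vecInner {m : ℕ} {p : M} (ξ : Fin m → TangentSpace (𝓡 n) p)
    (v : TangentSpace (𝓡 n) p) : Fin m → ℝ :=
  fun i ↦ inner ℝ (ξ i) v

/-- `Ψ : K → ℝᵐ` is `∂*_*`-convex at `p` over `K`, where `∂*_*Ψ(p)` is the product of the
sets `C i = ∂*_*Ψᵢ(p)`. -/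
def IsConvexWrtConvexificator {m : ℕ} {K : Set M} (Ψ : K → Fin m → ℝ) (p : K)
    (C : Fin m → Set (TangentSpace (𝓡 n) (p : M))) : Prop :=
  ∀ q : K, ∀ ξ ∈ Set.pi univ C, ∀ i, vecInner ξ (logMap n (p : M) (q : M)) i ≤ Ψ q i - Ψ p i

/-- The set `-ℝᵐ₊ \ {0}`. -/
def negOrthantDiffZero (m : ℕ) : Set (Fin m → ℝ) := {y | ∀ i, y i ≤ 0} \ {0}

/-- `p ∈ K` solves the Stampacchia `∂*_*`-VVIP over `K`, where `∂*_*Ψ(p)` is the product of the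
sets `C i = ∂*_*Ψᵢ(p)`. -/
def IsStampacchiaSolution {m : ℕ} {K : Set M} (p : K)
    (C : Fin m → Set (TangentSpace (𝓡 n) (p : M))) : Prop :=
  ∀ q : K, ∃ ξ ∈ Set.pi univ C, vecInner ξ (logMap n (p : M) (q : M)) ∉ negOrthantDiffZero m

/-- `p` is an efficient (minimal) point of the problem of minimizing `Ψ` over `K`. -/
def IsEfficient {m : ℕ} {K : Set M} (Ψ : K → Fin m → ℝ) (p : K) : Prop :=
  ∀ q : K, Ψ q - Ψ p ∉ negOrthantDiffZero m

end Coordinates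

/-- `f : K → ℝ` is locally Lipschitz at `p ∈ K`, for the Riemannian distance restricted
to `K`. -/
def LocallyLipschitzAt {X : Type*} [MetricSpace X] {K : Set X} (f : K → ℝ) (p : K) : Prop :=
  ∃ c : NNReal, ∃ U ∈ 𝓝 p, LipschitzOnWith c f U

/-- A Hadamard manifold: a complete, simply connected Riemannian manifold of nonpositive
sectional curvature. The type class arguments say that `M` is a smooth `n`-dimensional Riemannian
manifold whose distance is the Riemannian distance. -/
structure IsHadamardManifold (n : ℕ) (M : Type*) [MetricSpace M]
    [ChartedSpace (EuclideanSpace ℝ (Fin n)) M] [IsManifold (𝓡 n) ∞ M]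
    [RiemannianBundle (fun x : M ↦ TangentSpace (𝓡 n) x)]
    [IsContMDiffRiemannianBundle (𝓡 n) ∞ (EuclideanSpace ℝ (Fin n))
      (fun x : M ↦ TangentSpace (𝓡 n) x)]
    [IsRiemannianManifold (𝓡 n) M] : Prop where
  complete : CompleteSpace M
  simplyConnected : SimplyConnectedSpace M
  curvature_nonpos : ∀ (x : M) (u v : Fin n → ℝ), LinearIndependent ℝ ![u, v] →
    sectionalCurvature x u v ≤ 0

end Hadamard

end

/-! The argument is an order squeeze with respect to the pointed cone `ℝᵐ₊`. Suppose some `q`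
dominates `p`, and let `w` be the vector of pairings of the Stampacchia `ξ` for `q` with `exp_p⁻¹
q`. Convexity gives `w ≤ Ψ q - Ψ p ≤ 0` componentwise, so the Stampacchia condition leaves only `w =
0`. The same convexity inequality then reads `0 ≤ Ψ q - Ψ p`, so the difference vanishes,
contradicting strict domination. -/

theorem mainTheorem7 {n m : ℕ} {M : Type*} [MetricSpace M]
    [ChartedSpace (EuclideanSpace ℝ (Fin n)) M]
    [IsManifold (𝓡 n) ∞ M]
    [RiemannianBundle (fun x : M ↦ TangentSpace (𝓡 n) x)]
    [IsContMDiffRiemannianBundle (𝓡 n) ∞ (EuclideanSpace ℝ (Fin n))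
      (fun x : M ↦ TangentSpace (𝓡 n) x)]
    [IsRiemannianManifold (𝓡 n) M]
    (hM : Hadamard.IsHadamardManifold n M)
    (K : Set M) (hKne : K.Nonempty) (hK : Hadamard.GeodesicallyConvex n K)
    (Ψ : K → Fin m → ℝ)
    -- an extension of `Ψ` to `M`, with values in `[-∞, ∞]`, to which the Dini derivatives refer
    (F : Fin m → M → EReal) (hF : ∀ (i : Fin m) (q : K), F i q = (Ψ q i : EReal))
    (p : K) (hLip : ∀ i, Hadamard.LocallyLipschitzAt (fun q ↦ Ψ q i) p)
    (C : Fin m → Set (TangentSpace (𝓡 n) (p : M)))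
    (hC : ∀ i, Hadamard.IsConvexificator (F i) (p : M) (C i))
    (hCbdd : ∀ i, Bornology.IsBounded (C i))
    (hconv : Hadamard.IsConvexWrtConvexificator Ψ p C)
    (hStamp : Hadamard.IsStampacchiaSolution p C) :
    Hadamard.IsEfficient Ψ p := by
  intro q ⟨hle, hne⟩
  obtain ⟨ξ, hξ, hnot⟩ := hStamp q
  -- The Stampacchia `ξ` may change with `q`; this is harmless because convexity holds for every
  -- element of the product of the `C i`.
  have hinner := hconv q ξ hξ
  -- `⟨ξ; exp⁻¹ q⟩ₘ` is componentwise nonpositive, hence zero, which forces `Ψ q = Ψ p`.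
  have hzero : Hadamard.vecInner ξ (Hadamard.logMap n (p : M) (q : M)) = 0 := by
    by_contra h
    exact hnot ⟨fun i ↦ (hinner i).trans (hle i), h⟩
  -- Pointedness of the cone: with `hle` already giving `≤ 0`, only the reverse inequality is
  -- missing, and `hinner` supplies it now that its left side is zero.
  refine hne (funext fun i ↦ le_antisymm (hle i) ?_)
  have h := hinner i
  rw [hzero] at h
  exact h
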